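/- A graceful difference labeling (gdl) of a finite directed graph $G=(V,A)$ is a bijection $f:V\rightarrow\{1,\ldots,|V|\}$ such that, when each arc $uv\in A$ is assigned the difference label $f(v)-f(u)$, the labels of distinct arcs are distinct. For $k\ge 2$ let $\overrightarrow{C_k}$ denote the circuit with vertex set $\{v_1,\ldots,v_k\}$ and arc set $\{v_iv_{i+1}: 1\le i<k\}\cup\{v_kv_1\}$; $G+H$ denotes the disjoint union of $G$ and $H$, and $nG$ the disjoint union of $n$ copies of $G$. Then for every integer $n\ge 1$ the directed graph $\overrightarrow{C_4}+n\overrightarrow{C_3}$ has a gdl. -/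

import Mathlib

namespace Digraph

/-- A graceful difference labeling (gdl) of a finite directed graph: a bijection from the vertex set
onto `{1, …, |V|}` such that distinct arcs `uv`, `u'v'` receive distinct (signed) difference
labels `f v - f u`, `f v' - f u'`. -/
structure IsGracefulDifferenceLabeling {V : Type*} [Fintype V] (G : Digraph V) (f : V → ℕ) :
    Prop where
  bijOn : Set.BijOn f Set.univ (Set.Icc 1 (Fintype.card V))
  label_injective : ∀ u v u' v' : V, G.Adj u v → G.Adj u' v' →
    (f v : ℤ) - (f u : ℤ) = (f v' : ℤ) - (f u' : ℤ) → u = u' ∧ v = v'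

/-- The directed graph has a graceful difference labeling. -/
def HasGDL {V : Type*} [Fintype V] (G : Digraph V) : Prop :=
  ∃ f : V → ℕ, G.IsGracefulDifferenceLabeling f

/-- The circuit on the `k` vertices `0, …, k - 1` (for `k ≥ 2`): its arcs are `i → i + 1` for
`i + 1 < k`, together with `k - 1 → 0`. -/
def circuit (k : ℕ) : Digraph (Fin k) where
  Adj i j := (i : ℕ) + 1 = (j : ℕ) ∨ ((i : ℕ) + 1 = k ∧ (j : ℕ) = 0)

/-- The disjoint union of two directed graphs: the arcs are those of `G` and those of `H`. -/
def disjointUnion {V W : Type*} (G : Digraph V) (H : Digraph W) : Digraph (V ⊕ W) where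
  Adj := Sum.LiftRel G.Adj H.Adj

/-- The disjoint union of `p` copies of a directed graph. -/
def copies {V : Type*} (p : ℕ) (G : Digraph V) : Digraph (Fin p × V) where
  Adj x y := x.1 = y.1 ∧ G.Adj x.2 y.2

end Digraph

/-! The labeling is explicit. Write n = 3k + r with r < 3 and split 3k triangles into three families
of size k, labels being affine in the index i. Label slopes are ±1 or ±2: blocks of consecutive
integers and pairs interleaved by parity. Around a triangle the differences sum to zero, so their
slopes do too; up to sign they are 1, 3, 4 in one family and 1, 2, 3 in the others. The slope ±4
progression is odd and crosses zero, while the slope ±2 ones are even and of opposite signs. Two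
slope ±3 progressions overlap but differ mod 3; the remaining progressions occupy disjoint
intervals. The 4-circuit and the r exceptional triangles use the gaps. -/

namespace Digraph

/-- If, up to relabeling the vertices, every arc of `G` is of the form `w → s w`, then an injective
integer labeling with values in `[1, |V|]` whose differences `f (s w) - f w` are pairwise distinct
yields a graceful difference labeling of `G`. -/
theorem hasGDL_of_equiv {V W : Type*} [Fintype V] {G : Digraph V} (e : V ≃ W) (s : W → W)
    (hs : ∀ u v, G.Adj u v → e v = s (e u)) (f : W → ℤ) (hf : Function.Injective f)
    (hr : ∀ w, 1 ≤ f w ∧ f w ≤ Fintype.card V)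
    (hd : Function.Injective fun w => f (s w) - f w) : G.HasGDL := by
  have hcast : ∀ v, (((f (e v)).toNat : ℕ) : ℤ) = f (e v) := fun v =>
    Int.toNat_of_nonneg (by have := hr (e v); omega)
  have hinj : Function.Injective fun v => (f (e v)).toNat := by
    intro u v huv
    apply e.injective
    apply hf
    rw [← hcast u, ← hcast v]
    exact congrArg _ huv
  refine ⟨fun v => (f (e v)).toNat, ?_, ?_⟩
  · have hmaps : Set.MapsTo (fun v => (f (e v)).toNat) Set.univ
        (Set.Icc 1 (Fintype.card V)) := by
      intro v _
      have := hr (e v)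
      have := hcast v
      simp only [Set.mem_Icc]
      omega
    refine ⟨hmaps, hinj.injOn, ?_⟩
    -- Surjectivity by counting: the image of an injection into an interval of |V| integers is all
    -- of it.
    have himage : Finset.univ.image (fun v => (f (e v)).toNat) = Finset.Icc 1 (Fintype.card V) := by
      apply Finset.eq_of_subset_of_card_le
      · intro m hm
        obtain ⟨v, -, rfl⟩ := Finset.mem_image.1 hm
        exact Finset.mem_Icc.2 (hmaps (Set.mem_univ v))
      · rw [Finset.card_image_of_injective _ hinj]
        simp
    intro m hm
    have hm' : m ∈ Finset.univ.image (fun v => (f (e v)).toNat) := by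
      rw [himage]
      exact Finset.mem_Icc.2 hm
    obtain ⟨v, -, hv⟩ := Finset.mem_image.1 hm'
    exact ⟨v, Set.mem_univ v, hv⟩
  · intro u v u' v' huv huv' h
    simp only [hcast] at h
    rw [hs u v huv, hs u' v' huv'] at h
    have hu : u = u' := e.injective (hd h)
    refine ⟨hu, e.injective ?_⟩
    rw [hs u v huv, hs u' v' huv', hu]

/-- Vertices of one circuit of length four and `3 * k + r` triangles, of which `3 * k` are grouped
into three families of size `k`. -/
abbrev FamilyVertex (k r : ℕ) : Type := Fin 4 ⊕ ((Fin 3 × Fin k) ⊕ Fin r) × Fin 3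

/-- The successor of a vertex along its circuit. -/
def FamilyVertex.succ {k r : ℕ} : FamilyVertex k r → FamilyVertex k r :=
  Sum.map (· + 1) (Prod.map id (· + 1))

/-- The labeling with labels `c` on the circuit of length four, `x g j i` on the `i`-th triangle of
family `g`, and `y e` on the exceptional triangle `e`. -/
def familyLabel {k r : ℕ} (c : Fin 4 → ℤ) (x : Fin 3 → Fin 3 → ℤ → ℤ) (y : Fin r → Fin 3 → ℤ) :
    FamilyVertex k r → ℤ
  | .inl j => c j
  | .inr (.inl (g, i), j) => x g j (i : ℕ)
  | .inr (.inr e, j) => y e j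

/-- A function on `FamilyVertex k r` given by tables is injective as soon as the entries of the
tables are pairwise distinct. -/
theorem familyLabel_injective {k r : ℕ} {c : Fin 4 → ℤ} {x : Fin 3 → Fin 3 → ℤ → ℤ}
    {y : Fin r → Fin 3 → ℤ}
    (hcc : ∀ j j', c j = c j' → j = j')
    (hyy : ∀ e e' j j', y e j = y e' j' → e = e' ∧ j = j')
    (hcy : ∀ j e j', c j ≠ y e j')
    (hxc : ∀ g j j', ∀ i : ℤ, 0 ≤ i → i < k → x g j i ≠ c j')
    (hxy : ∀ g j e j', ∀ i : ℤ, 0 ≤ i → i < k → x g j i ≠ y e j')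
    (hxx : ∀ g g' j j', ∀ i i' : ℤ, 0 ≤ i → i < k → 0 ≤ i' → i' < k →
      x g j i = x g' j' i' → g = g' ∧ j = j' ∧ i = i') :
    Function.Injective (familyLabel c x y : FamilyVertex k r → ℤ) := by
  have h0 : ∀ i : Fin k, (0 : ℤ) ≤ (i : ℕ) := fun i => by omega
  have h1 : ∀ i : Fin k, (((i : ℕ) : ℤ)) < k := fun i => by omega
  rintro (j | ⟨⟨g, i⟩ | e, j⟩) (j' | ⟨⟨g', i'⟩ | e', j'⟩) h <;> simp only [familyLabel] at h
  · rw [hcc _ _ h]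
  · exact (hxc _ _ _ _ (h0 i') (h1 i') h.symm).elim
  · exact (hcy _ _ _ h).elim
  · exact (hxc _ _ _ _ (h0 i) (h1 i) h).elim
  · obtain ⟨rfl, rfl, hi⟩ := hxx _ _ _ _ _ _ (h0 i) (h1 i) (h0 i') (h1 i') h
    rw [Fin.ext (Int.ofNat_inj.1 hi)]
  · exact (hxy _ _ _ _ _ (h0 i) (h1 i) h).elim
  · exact (hcy _ _ _ h.symm).elim
  · exact (hxy _ _ _ _ _ (h0 i') (h1 i') h.symm).elim
  · obtain ⟨rfl, rfl⟩ := hyy _ _ _ _ h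
    rfl

/-- Differences form a table of the same shape, so `familyLabel_injective` serves for both labels
and differences. -/
theorem familyLabel_succ_sub {k r : ℕ} (c : Fin 4 → ℤ) (x : Fin 3 → Fin 3 → ℤ → ℤ)
    (y : Fin r → Fin 3 → ℤ) :
    (fun w : FamilyVertex k r => familyLabel c x y w.succ - familyLabel c x y w) =
      familyLabel (fun j => c (j + 1) - c j) (fun g j i => x g (j + 1) i - x g j i)
        (fun e j => y e (j + 1) - y e j) := by
  funext w
  obtain j | ⟨⟨g, i⟩ | e, j⟩ := w <;> rfl

theorem circuit_adj_add_one {m : ℕ} {u v : Fin (m + 1)} (h : (circuit (m + 1)).Adj u v) :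
    v = u + 1 := by
  apply Fin.ext
  obtain h | ⟨h, h'⟩ := h
  · rw [Fin.val_add_one_of_lt' (by omega), h]
  · rw [show u = Fin.last m from Fin.ext (by simpa using h), Fin.last_add_one, h']
    rfl

/-- The vertices of the circuit of length four and `3 * k + r` triangles, in families. -/
def familyEquiv (k r : ℕ) : Fin 4 ⊕ Fin (3 * k + r) × Fin 3 ≃ FamilyVertex k r :=
  Equiv.sumCongr (Equiv.refl _) (Equiv.prodCongr
    (finSumFinEquiv.symm.trans (Equiv.sumCongr finProdFinEquiv.symm (Equiv.refl _)))
    (Equiv.refl _))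

theorem hasGDL_of_familyLabel {k r : ℕ} (c : Fin 4 → ℤ) (x : Fin 3 → Fin 3 → ℤ → ℤ)
    (y : Fin r → Fin 3 → ℤ)
    (hinj : Function.Injective (familyLabel c x y : FamilyVertex k r → ℤ))
    (hc : ∀ j, 1 ≤ c j ∧ c j ≤ 9 * k + 3 * r + 4)
    (hx : ∀ g j, ∀ i : ℤ, 0 ≤ i → i < k → 1 ≤ x g j i ∧ x g j i ≤ 9 * k + 3 * r + 4)
    (hy : ∀ e j, 1 ≤ y e j ∧ y e j ≤ 9 * k + 3 * r + 4)
    (hdiff : Function.Injective (familyLabel (fun j => c (j + 1) - c j)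
      (fun g j i => x g (j + 1) i - x g j i) (fun e j => y e (j + 1) - y e j) :
        FamilyVertex k r → ℤ)) :
    ((circuit 4).disjointUnion (copies (3 * k + r) (circuit 3))).HasGDL := by
  refine hasGDL_of_equiv (familyEquiv k r) FamilyVertex.succ ?_ (familyLabel c x y) hinj ?_ ?_
  · rintro (u | ⟨t, u⟩) (v | ⟨t', v⟩) h
    · cases h with
      | inl h => rw [circuit_adj_add_one h]; rfl
    · cases h
    · cases h
    · cases h with
      | inr h =>
        obtain ⟨rfl, h⟩ : t = t' ∧ (circuit 3).Adj u v := h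
        rw [circuit_adj_add_one h]
        rfl
  · have hcard : (Fintype.card (Fin 4 ⊕ Fin (3 * k + r) × Fin 3) : ℤ) = 9 * k + 3 * r + 4 := by
      simp only [Fintype.card_sum, Fintype.card_prod, Fintype.card_fin]
      push_cast
      ring
    rw [hcard]
    rintro (j | ⟨⟨g, i⟩ | e, j⟩)
    · exact hc j
    · exact hx g j _ (by omega) (by omega)
    · exact hy e j
  · rw [familyLabel_succ_sub]
    exact hdiff

theorem forall_fin_three {P : Fin 3 → Prop} : (∀ j, P j) ↔ P 0 ∧ P 1 ∧ P 2 := by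
  refine ⟨fun h => ⟨h 0, h 1, h 2⟩, fun ⟨h0, h1, h2⟩ j => ?_⟩
  fin_cases j <;> assumption

theorem forall_fin_four {P : Fin 4 → Prop} : (∀ j, P j) ↔ P 0 ∧ P 1 ∧ P 2 ∧ P 3 := by
  refine ⟨fun h => ⟨h 0, h 1, h 2, h 3⟩, fun ⟨h0, h1, h2, h3⟩ j => ?_⟩
  fin_cases j <;> assumption

/-- The odd differences 2k-1-4i avoid the even ±(2i+2), and 2k+2+3i, 2k+3+3i differ mod 3. At k = 0
the circuit differences -4k-2 and -6k-2 would collide. -/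
theorem hasGDL_circuit_four_add_three_mul (k : ℕ) (hk : 1 ≤ k) :
    ((circuit 4).disjointUnion (copies (3 * k + 0) (circuit 3))).HasGDL := by
  apply hasGDL_of_familyLabel
    ![(k : ℤ) + 1, 9 * k + 4, 5 * k + 2, 7 * k + 3]
    ![![fun i => 4 * k + 1 - 2 * i, fun i => 6 * k + i + 3, fun i => 2 * k + 2 * i + 2],
      ![fun i => 7 * k + 2 * i + 5, fun i => k - i, fun i => k + i + 2],
      ![fun i => 5 * k + i + 3, fun i => 5 * k + 1 - i, fun i => 7 * k + 2 * i + 4]]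
    ![]
  case' hinj => apply familyLabel_injective
  case' hdiff => apply familyLabel_injective
  all_goals
    simp only [forall_fin_three, forall_fin_four, IsEmpty.forall_iff, Fin.isValue,
      Fin.reduceAdd, Fin.reduceEq, Matrix.cons_val, and_true, true_and, false_and, and_false,
      imp_false, implies_true, ne_eq]
  -- Each entry or pair of entries is now a linear arithmetic statement in k and the integer
  -- indices, parity and residues mod 3 included.
  all_goals and_intros
  all_goals
    intros
    omega

/-- Here the odd progression is -2k+1+4i, and the pair separated mod 3 is 5k-1-3i, 5k+1-3i. At k = 0
the families are empty, which settles n = 1. -/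
theorem hasGDL_circuit_four_add_three_mul_add_one (k : ℕ) :
    ((circuit 4).disjointUnion (copies (3 * k + 1) (circuit 3))).HasGDL := by
  apply hasGDL_of_familyLabel
    ![(1 : ℤ), 8 * k + 7, 8 * k + 5, 6 * k + 4]
    ![![fun i => 7 * k + i + 5, fun i => k + 2 * i + 3, fun i => 9 * k + 7 - i],
      ![fun i => 6 * k + 3 - i, fun i => 6 * k + i + 5, fun i => k + 2 * i + 4],
      ![fun i => i + 2, fun i => 5 * k + 3 - 2 * i, fun i => 3 * k + 2 * i + 4]]
    ![![(k : ℤ) + 2, 3 * k + 3, 8 * k + 6]]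
  case' hinj => apply familyLabel_injective
  case' hdiff => apply familyLabel_injective
  all_goals
    simp only [forall_fin_three, forall_fin_four, Fin.forall_fin_one, Fin.isValue,
      Fin.reduceAdd, Fin.reduceEq, Matrix.cons_val, and_true, true_and, false_and, and_false,
      imp_false, implies_true, ne_eq]
  all_goals and_intros
  all_goals
    intros
    omega

/-- Here the odd progression is -2k+3+4i, and the pair separated mod 3 is -2k-1-3i, -2k-5-3i. The
exceptional difference -5k-1 is the first term past the end of the former. -/
theorem hasGDL_circuit_four_add_three_mul_add_two (k : ℕ) :
    ((circuit 4).disjointUnion (copies (3 * k + 2) (circuit 3))).HasGDL := by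
  apply hasGDL_of_familyLabel
    ![(1 : ℤ), 8 * k + 7, 3 * k + 3, 9 * k + 10]
    ![![fun i => 8 * k + i + 9, fun i => 6 * k + 4 - 2 * i, fun i => 4 * k + 2 * i + 7],
      ![fun i => k + 1 - i, fun i => k + i + 3, fun i => 6 * k + 2 * i + 7],
      ![fun i => 2 * k + i + 3, fun i => 6 * k + 2 * i + 6, fun i => 4 * k + 5 - i]]
    ![![(k : ℤ) + 2, 3 * k + 4, 9 * k + 9], ![3 * (k : ℤ) + 5, 8 * k + 8, 8 * k + 6]]
  case' hinj => apply familyLabel_injective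
  case' hdiff => apply familyLabel_injective
  all_goals
    simp only [forall_fin_three, forall_fin_four, Fin.forall_fin_two, Fin.isValue,
      Fin.reduceAdd, Fin.reduceEq, Matrix.cons_val, and_true, true_and, false_and, and_false,
      imp_false, implies_true, ne_eq]
  all_goals and_intros
  all_goals
    intros
    omega

end Digraph

theorem lemma8 (n : ℕ) (hn : 1 ≤ n) :
    ((Digraph.circuit 4).disjointUnion (Digraph.copies n (Digraph.circuit 3))).HasGDL := by
  obtain ⟨k, rfl | rfl | rfl⟩ : ∃ k, n = 3 * k + 0 ∨ n = 3 * k + 1 ∨ n = 3 * k + 2 :=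
    ⟨n / 3, by omega⟩
  · exact Digraph.hasGDL_circuit_four_add_three_mul k (by omega)
  · exact Digraph.hasGDL_circuit_four_add_three_mul_add_one k
  · exact Digraph.hasGDL_circuit_four_add_three_mul_add_two k
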